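/- \textbf{Setting.} Let $G=(V,E)$ be a finite simple graph and $V_M\subseteq V$ a set of marked vertices. Let $N(v)$ denote the set of neighbours of $v$ and $\deg_G(v)=|N(v)|$. The coined quantum walk search for $V_M$ acts on the complex Hilbert space with orthonormal basis $\{|v,w\rangle : v\in V,\ w\in N(v)\}$. One step is $U=SCQ$, where - $Q|v,w\rangle=-|v,w\rangle$ if $v\in V_M$ and $Q|v,w\rangle=|v,w\rangle$ otherwise; - $C$ acts at each vertex $v$ as Grover's diffusion $2|s_v\rangle\langle s_v|-I$ on the coin register, with $|s_v\rangle=\deg_G(v)^{-1/2}\sum_{w\in N(v)}|w\rangle$; - $S|v,w\rangle=|w,v\rangle$. The walk starts in $|\psi_0\rangle=\frac1{\sqrt{2|E|}}\sum_{v\in V}\sum_{w\in N(v)}|v,w\rangle$. For $t\in\{0,1,2,\dots\}$, the probability of finding a marked vertex at time $t$ is $p_M(t)=\sum_{v\in V_M}\sum_{w\in N(v)}|\langle v,w|U^t|\psi_0\rangle|^2$. Let $G_M=(V_M,E_M)$ be the subgraph of $G$ induced by $V_M$. It is called a \emph{single-amplitude marked component} (SAMC) of $G$ if $1<|V_M|<|V|$,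 $G_M$ is connected, and either $G_M$ is non-bipartite, or $G_M$ is bipartite with parts $U_M$ and $V_M\setminus U_M$ satisfying $\sum_{u\in U_M}\deg_G(u)=\sum_{v\in V_M\setminus U_M}\deg_G(v)$. Let $K(v)=-|N(v)\setminus V_M|$ for $v\in V_M$ be the conditioning function, let $\|K\|=\max_{v\in V_M}|K(v)|$, and let $D^{\bar M}$ be the number of edges between $V_M$ and $V\setminus V_M$. \textbf{Theorem.} There is an absolute constant $C>0$ such that for every finite connected simple graph $G=(V,E)$ and every SAMC $G_M=(V_M,E_M)$ of $G$, $$\sup_{t\ge 0}\, p_M(t)\;\le\; C\cdot\frac{|V_M|^3\,\|K\|^2}{2|E|-2|E_M|-D^{\bar M}}.$$ -/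

import Mathlib

namespace CoinedWalk

variable {V : Type*} [Fintype V] [DecidableEq V] (G : SimpleGraph V) [DecidableRel G.Adj]

/-- The state space of the coined walk: the Hilbert space with orthonormal basis the arcs
`|v, w⟩`, `v ∈ V`, `w ∈ N(v)` (location `v`, direction `w`). -/
abbrev State : Type _ := EuclideanSpace ℂ G.Dart

/-- The query `Q`: it maps `|v, w⟩` to `-|v, w⟩` if `v` is marked, and fixes it otherwise. -/
noncomputable def query (M : Finset V) : Module.End ℂ (State G) where
  toFun ψ := WithLp.toLp 2 fun d => if d.fst ∈ M then -ψ d else ψ d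
  map_add' ψ φ := by
    ext d
    by_cases h : d.fst ∈ M <;> simp [h, add_comm]
  map_smul' a ψ := by
    ext d
    by_cases h : d.fst ∈ M <;> simp [h]

/-- The coin `C`: at each vertex `v`, Grover's diffusion `2 |s_v⟩⟨s_v| - I` on the coin register,
where `s_v` is the uniform superposition of the `deg v` directions at `v`. -/
noncomputable def coin : Module.End ℂ (State G) where
  toFun ψ := WithLp.toLp 2 fun d =>
    2 / (G.degree d.fst : ℂ) * ∑ e : G.Dart with e.fst = d.fst, ψ e - ψ d
  map_add' ψ φ := by
    ext d
    simp only [PiLp.add_apply, Finset.sum_add_distrib]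
    ring
  map_smul' a ψ := by
    ext d
    simp only [PiLp.smul_apply, smul_eq_mul, ← Finset.mul_sum, RingHom.id_apply]
    ring

/-- The shift `S`, which swaps the amplitudes of the arcs `(v, w)` and `(w, v)`. -/
noncomputable def shift : Module.End ℂ (State G) where
  toFun ψ := WithLp.toLp 2 fun d => ψ d.symm
  map_add' _ _ := rfl
  map_smul' _ _ := rfl

/-- One step `U = S C Q` of the quantum search. -/
noncomputable def step (M : Finset V) : Module.End ℂ (State G) :=
  shift G * coin G * query G M

/-- The initial state: the equal superposition of all arcs. -/
noncomputable def initial : State G :=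
  WithLp.toLp 2 fun _ => 1 / (Real.sqrt (2 * (G.edgeFinset.card : ℝ)) : ℂ)

/-- The probability `p_M(t)` of finding a vertex of `M` when the location register is measured
after `t` steps of the search for `M`. -/
noncomputable def successProb (M : Finset V) (t : ℕ) : ℝ :=
  ∑ d : G.Dart with d.fst ∈ M, ‖((step G M ^ t) (initial G)) d‖ ^ 2

/-- `M` spans a single-amplitude marked component (SAMC) of `G`: `1 < |M| < |V|`, the subgraph
induced by `M` is connected, and it is either non-bipartite, or bipartite with the two parts `U`
and `M \ U` having the same sum of degrees in `G`. -/
structure IsSAMC (M : Finset V) : Prop where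
  one_lt_card : 1 < M.card
  card_lt : M.card < Fintype.card V
  connected : (G.induce (M : Set V)).Connected
  balanced : ¬ (G.induce (M : Set V)).IsBipartite ∨
    ∃ U ⊆ M, (G.induce (M : Set V)).IsBipartiteWith {v | v.1 ∈ U} {v | v.1 ∈ M \ U} ∧
      ∑ u ∈ U, G.degree u = ∑ v ∈ M \ U, G.degree v

/-- The conditioning function `K(v) = -|N(v) \ M|` on `M`. As a function on a finite type it
carries the norm `‖K‖ = max_{v ∈ M} |K(v)|`. -/
def conditioning (M : Finset V) : M → ℝ :=
  fun v => -((G.neighborFinset v.1 \ M).card : ℝ)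

/-- `|E_M|`, the number of edges of the subgraph induced by `M`. -/
def innerEdges (M : Finset V) : ℕ := (G.induce (M : Set V)).edgeFinset.card

/-- The number of edges from `M` to `V \ M`. An edge that leaves `M` has exactly one end in `M`,
so it is counted by exactly one pair in `M × (V \ M)`. -/
def boundaryEdges (M : Finset V) : ℕ := (G.interedges M Mᶜ).card

end CoinedWalk

namespace CoinedWalk

open Finset

/-! The walk barely moves because `initial` lies close to a stationary state. A symmetric arc
function that is constant on arcs at unmarked vertices and sums to zero at every marked vertex is
fixed by `step` (`step_apply_eq_self`). Since `step` is norm-preserving, the success probability at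
every time is controlled by the marked part of this state and its distance to `initial`
(`successProb_le_of_fixed`).

Such a state exists with small energy: inside the marked component one needs edge weights with
vertex sums `K` (`exists_edge_weight`). Each demand `K u` is carried to a root along a path with
alternating signs, which leaves a residue at the root only. The degree balance kills the residue in
the bipartite case; in the non-bipartite case an odd closed walk through the root absorbs it. Paths
have fewer than `n` edges, so Cauchy-Schwarz gives energy of order `n ^ 3 * k ^ 2`. -/

/-! ### Edge weights with prescribed vertex sums. -/

theorem sum_sq_le_length {W : Type*} [Fintype W] [DecidableEq W] {H : SimpleGraph W} {u v : W}
    (p : H.Walk u v) (hp : p.IsPath) (f : Sym2 W → ℝ)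
    (hf : ∀ e, |f e| ≤ p.edges.count e) : ∑ e, f e ^ 2 ≤ Fintype.card W := by
  have h1 : ∀ e, f e ^ 2 ≤ if e ∈ p.edges.toFinset then 1 else 0 := by
    intro e
    have h2 := hf e
    by_cases he : e ∈ p.edges
    · rw [List.count_eq_one_of_mem hp.isTrail.edges_nodup he] at h2
      simp only [List.mem_toFinset, he, if_true]
      rw [← sq_abs]
      have := abs_nonneg (f e)
      push_cast at h2
      nlinarith
    · rw [List.count_eq_zero_of_not_mem he] at h2
      simp only [List.mem_toFinset, he, if_false]
      rw [← sq_abs]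
      have := abs_nonneg (f e)
      push_cast at h2
      nlinarith
  refine (Finset.sum_le_sum fun e _ => h1 e).trans ?_
  rw [Finset.sum_ite_mem, univ_inter, Finset.sum_const, nsmul_eq_mul, mul_one]
  have h2 := List.toFinset_card_le p.edges
  rw [SimpleGraph.Walk.length_edges] at h2
  exact_mod_cast h2.trans hp.length_lt.le

/-- Each step flips `σ`, so the parity of a walk depends on its ends alone; this identifies the
root's residue with the `σ`-signed sum of `K`. -/
theorem neg_one_pow_length {W : Type*} {H : SimpleGraph W} {u v : W} (p : H.Walk u v) (σ : W → ℝ)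
    (hσ : ∀ x, σ x ^ 2 = 1) (hadj : ∀ x y, H.Adj x y → σ x = -σ y) :
    (-1) ^ p.length = σ u * σ v := by
  induction p with
  | nil => have := hσ ‹_›; simp [← this, sq]
  | cons h p ih =>
    rw [SimpleGraph.Walk.length_cons, pow_succ, ih, hadj _ _ h]
    ring

theorem sum_sq_add_le {ι : Type*} [Fintype ι] (f g : ι → ℝ) :
    ∑ e, (f e + g e) ^ 2 ≤ 2 * ∑ e, f e ^ 2 + 2 * ∑ e, g e ^ 2 := by
  rw [Finset.mul_sum, Finset.mul_sum, ← Finset.sum_add_distrib]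
  exact Finset.sum_le_sum fun e _ => by nlinarith [sq_nonneg (f e - g e)]

section Graph

variable {W : Type*} [Fintype W] [DecidableEq W] (H : SimpleGraph W) [DecidableRel H.Adj]

theorem sum_dart_fst_eq {R : Type*} [AddCommMonoid R] (v : W) (g : W → W → R) :
    ∑ d : H.Dart with d.fst = v, g d.fst d.snd = ∑ w ∈ H.neighborFinset v, g v w := by
  refine Finset.sum_bij' (fun d _ => d.snd)
    (fun w hw => ⟨(v, w), (H.mem_neighborFinset v w).1 hw⟩) ?_ ?_ ?_ ?_ ?_
  · intro d hd
    simp only [mem_filter, mem_univ, true_and] at hd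
    simp [← hd]
  · intro w hw
    simp
  · intro d hd
    simp only [mem_filter, mem_univ, true_and] at hd
    ext <;> simp [hd]
  · intro w hw
    rfl
  · intro d hd
    simp only [mem_filter, mem_univ, true_and] at hd
    simp [hd]

theorem sum_dart_fst_mem {R : Type*} [AddCommMonoid R] (M : Finset W) (g : W → W → R) :
    ∑ d : H.Dart with d.fst ∈ M, g d.fst d.snd = ∑ v ∈ M, ∑ w ∈ H.neighborFinset v, g v w := by
  rw [← Finset.sum_fiberwise_of_maps_to (t := M) (g := fun d : H.Dart => d.fst)
    (by intro d hd; simpa using hd)]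
  refine Finset.sum_congr rfl fun v hv => ?_
  rw [← sum_dart_fst_eq, Finset.filter_filter]
  refine Finset.sum_congr ?_ fun _ _ => rfl
  ext d
  simp only [mem_filter, mem_univ, true_and]
  exact ⟨fun h => h.2, fun h => ⟨h ▸ hv, h⟩⟩

theorem sum_neighbor_edge_le (q : Sym2 W → ℝ) (hq : ∀ e, 0 ≤ q e) :
    ∑ x, ∑ y ∈ H.neighborFinset x, q s(x, y) ≤ 2 * ∑ e, q e := by
  rw [← sum_dart_fst_mem H univ fun x y => q s(x, y)]
  simp only [mem_univ, filter_true]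
  rw [← Finset.sum_fiberwise (s := univ) (g := fun d : H.Dart => d.edge), Finset.mul_sum]
  refine Finset.sum_le_sum fun e _ => ?_
  have h1 : ∑ d : H.Dart with d.edge = e, q s(d.fst, d.snd)
      = (#{d : H.Dart | d.edge = e} : ℝ) * q e := by
    rw [Finset.sum_congr rfl (g := fun _ => q e), Finset.sum_const, nsmul_eq_mul]
    intro d hd
    simp only [mem_filter, mem_univ, true_and] at hd
    rw [← hd]
    rfl
  rw [h1]
  refine mul_le_mul_of_nonneg_right ?_ (hq e)
  by_cases he : e ∈ H.edgeSet
  · rw [H.dart_edge_fiber_card e he]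
    norm_num
  · rw [Finset.card_eq_zero.2]
    · norm_num
    · ext d
      simp only [mem_filter, mem_univ, true_and, notMem_empty, iff_false]
      rintro rfl
      exact he d.edge_mem

theorem sum_neighbor_pi_single {u v : W} (h : H.Adj u v) (x : W) :
    ∑ y ∈ H.neighborFinset x, (Pi.single s(u, v) (1 : ℝ) : Sym2 W → ℝ) s(x, y)
      = (Pi.single u 1 : W → ℝ) x + (Pi.single v 1 : W → ℝ) x := by
  have huv := h.ne
  by_cases hu : x = u
  · subst hu
    rw [Finset.sum_eq_single v]
    · simp [huv]
    · intro y _ hy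
      rw [Pi.single_eq_of_ne]
      simp only [ne_eq, Sym2.eq_iff, true_and, not_or, not_and]
      exact ⟨hy, fun h => absurd h huv⟩
    · intro hn
      exact absurd ((H.mem_neighborFinset _ _).2 h) hn
  by_cases hv : x = v
  · subst hv
    rw [Finset.sum_eq_single u]
    · rw [Sym2.eq_swap]
      simp [hu]
    · intro y _ hy
      rw [Pi.single_eq_of_ne]
      simp only [ne_eq, Sym2.eq_iff, true_and, not_or, not_and]
      exact ⟨fun h => absurd h hu, hy⟩
    · intro hn
      exact absurd ((H.mem_neighborFinset _ _).2 h.symm) hn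
  · rw [Finset.sum_eq_zero]
    · simp [hu, hv]
    · intro y _
      rw [Pi.single_eq_of_ne]
      simp [hu, hv]

/-- The alternating edge weight along a walk has vertex sums concentrated at its two ends. -/
theorem exists_alternating_weight {u v : W} (p : H.Walk u v) :
    ∃ f : Sym2 W → ℝ, (∀ e, |f e| ≤ p.edges.count e) ∧
      ∀ x, ∑ y ∈ H.neighborFinset x, f s(x, y)
        = (Pi.single u 1 : W → ℝ) x - (-1) ^ p.length * (Pi.single v 1 : W → ℝ) x := by
  induction p with
  | nil => exact ⟨0, by simp, by simp⟩
  | @cons a b c h p ih =>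
    obtain ⟨f, hf, hs⟩ := ih
    -- The new edge has weight 1 and the old weights change sign, so the contributions at `b`
    -- cancel.
    refine ⟨Pi.single s(a, b) 1 - f, fun e => ?_, fun x => ?_⟩
    · have h1 : |(Pi.single s(a, b) 1 : Sym2 W → ℝ) e| ≤ if s(a, b) = e then 1 else 0 := by
        by_cases he : s(a, b) = e
        · subst he; simp
        · simp [he]
      have h2 := abs_sub ((Pi.single s(a, b) 1 : Sym2 W → ℝ) e) (f e)
      have h3 := hf e
      rw [SimpleGraph.Walk.edges_cons, List.count_cons]
      simp only [Pi.sub_apply]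
      push_cast
      simp only [beq_iff_eq]
      linarith
    · simp only [Pi.sub_apply, Finset.sum_sub_distrib, hs, sum_neighbor_pi_single H h,
        SimpleGraph.Walk.length_cons]
      ring

/-- On a connected graph, vertex sums `K` that are balanced whenever the graph is bipartite are
realised by an edge weight of energy at most a constant times `n ^ 3 * k ^ 2`. -/
theorem exists_edge_weight (hH : H.Connected) (K : W → ℝ) (k : ℝ) (hk : ∀ x, |K x| ≤ k)
    (hbal : ¬ H.IsBipartite ∨ ∃ σ : W → ℝ, (∀ x, σ x ^ 2 = 1) ∧
      (∀ x y, H.Adj x y → σ x = -σ y) ∧ ∑ x, σ x * K x = 0) :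
    ∃ f : Sym2 W → ℝ, (∀ x, ∑ y ∈ H.neighborFinset x, f s(x, y) = K x) ∧
      ∑ e, f e ^ 2 ≤ 8 * ((Fintype.card W : ℝ) ^ 3 * k ^ 2) := by
  obtain ⟨r⟩ := hH.nonempty
  have hk0 : 0 ≤ k := (abs_nonneg _).trans (hk r)
  have hn : (1 : ℝ) ≤ Fintype.card W := by
    exact_mod_cast Fintype.card_pos_iff.2 ⟨r⟩
  set n : ℝ := (Fintype.card W : ℝ)
  choose p hp using fun u => (hH.preconnected u r).exists_isPath
  choose P hP hPs using fun u => exists_alternating_weight H (p u)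
  have hPn : ∀ u, ∑ e, P u e ^ 2 ≤ n := fun u => sum_sq_le_length (p u) (hp u) _ (hP u)
  set τ : W → ℝ := fun u => (-1) ^ (p u).length with hτ
  have hτsq : ∀ u, τ u ^ 2 = 1 := fun u => by
    simp only [hτ]
    rw [← pow_mul, mul_comm, pow_mul]
    simp
  set F : Sym2 W → ℝ := fun e => ∑ u, K u * P u e with hF
  -- The residue that all the paths together leave at the root `r`.
  set ρ : ℝ := ∑ u, τ u * K u with hρ
  have hFs : ∀ x, ∑ y ∈ H.neighborFinset x, F s(x, y)
      = K x - ρ * (Pi.single r 1 : W → ℝ) x := by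
    intro x
    simp only [hF]
    rw [Finset.sum_comm]
    simp only [← Finset.mul_sum, hPs, mul_sub, Finset.sum_sub_distrib]
    rw [hρ, Finset.sum_mul]
    congr 1
    · rw [Finset.sum_eq_single x]
      · simp
      · intro b _ hb
        simp [Pi.single_eq_of_ne' hb]
      · simp
    · exact Finset.sum_congr rfl fun u _ => by simp only [hτ]; ring
  have hKsq : ∀ u, K u ^ 2 ≤ k ^ 2 := fun u => sq_le_sq.2 (by
    rw [abs_of_nonneg hk0]; exact hk u)
  have hFn : ∑ e, F e ^ 2 ≤ n ^ 3 * k ^ 2 := by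
    calc ∑ e, F e ^ 2 ≤ ∑ e, n * ∑ u, (K u * P u e) ^ 2 := by
          refine Finset.sum_le_sum fun e _ => ?_
          have := sq_sum_le_card_mul_sum_sq (s := (univ : Finset W)) (f := fun u => K u * P u e)
          simpa using this
      _ = n * ∑ u, K u ^ 2 * ∑ e, P u e ^ 2 := by
          rw [← Finset.mul_sum, Finset.sum_comm]
          simp only [mul_pow, Finset.mul_sum]
      _ ≤ n * ∑ _u : W, k ^ 2 * n := by
          refine mul_le_mul_of_nonneg_left (Finset.sum_le_sum fun u _ => ?_) (by positivity)
          exact mul_le_mul (hKsq u) (hPn u) (Finset.sum_nonneg fun e _ => sq_nonneg _)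
            (sq_nonneg k)
      _ = n ^ 3 * k ^ 2 := by
          rw [Finset.sum_const, nsmul_eq_mul, Finset.card_univ]
          ring
  have hpos : 0 ≤ n ^ 3 * k ^ 2 := by positivity
  rcases hbal with hnb | ⟨σ, hσ, hadj, hsum⟩
  -- Without such an edge the path parities `τ` would be a proper 2-colouring.
  · have : ∃ x y, H.Adj x y ∧ τ x = τ y := by
      by_contra! hcon
      refine hnb ⟨SimpleGraph.Coloring.mk (fun x => if τ x = 1 then (0 : Fin 2) else 1) ?_⟩
      intro x y hxy heq
      have hne := hcon x y hxy
      have hτ1 : ∀ u, τ u = 1 ∨ τ u = -1 := fun u =>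
        mul_self_eq_one_iff.1 (by rw [← sq]; exact hτsq u)
      by_cases h1 : τ x = 1
      · by_cases h2 : τ y = 1
        · exact hne (h1.trans h2.symm)
        · rw [if_pos h1, if_neg h2] at heq
          exact absurd heq (by decide)
      · by_cases h2 : τ y = 1
        · rw [if_neg h1, if_pos h2] at heq
          exact absurd heq (by decide)
        · exact hne (((hτ1 x).resolve_left h1).trans ((hτ1 y).resolve_left h2).symm)
    obtain ⟨x, y, hxy, hτxy⟩ := this
    -- The paths from `x` and `y` close up with the edge `xy` to an odd closed walk: `P x + P y - D`
    -- has vertex sum `-2 * τ x` at `r` and zero elsewhere. The factor `c` makes this equal to `ρ`.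
    set D : Sym2 W → ℝ := Pi.single s(x, y) 1 with hD
    set c : ℝ := -(ρ * τ x / 2) with hc
    have hDn : ∑ e, D e ^ 2 = 1 := by
      rw [Finset.sum_eq_single s(x, y)]
      · simp [hD]
      · intro b _ hb
        simp [hD, Pi.single_eq_of_ne hb]
      · simp
    have hρn : ρ ^ 2 ≤ n ^ 2 * k ^ 2 := by
      calc ρ ^ 2 ≤ n * ∑ u, (τ u * K u) ^ 2 := by
            have := sq_sum_le_card_mul_sum_sq (s := (univ : Finset W)) (f := fun u => τ u * K u)
            simpa using this
        _ ≤ n * ∑ _u : W, k ^ 2 := by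
            refine mul_le_mul_of_nonneg_left (Finset.sum_le_sum fun u _ => ?_) (by positivity)
            rw [mul_pow, hτsq, one_mul]
            exact hKsq u
        _ = n ^ 2 * k ^ 2 := by
            rw [Finset.sum_const, nsmul_eq_mul, Finset.card_univ]
            ring
    have hcn : c ^ 2 ≤ n ^ 2 * k ^ 2 / 4 := by
      have : c ^ 2 = ρ ^ 2 * τ x ^ 2 / 4 := by rw [hc]; ring
      rw [this, hτsq]
      linarith
    refine ⟨fun e => F e + c * (P x e + P y e - D e), fun z => ?_, ?_⟩
    · rw [Finset.sum_add_distrib, ← Finset.mul_sum, Finset.sum_sub_distrib,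
        Finset.sum_add_distrib, hFs, hPs, hPs, sum_neighbor_pi_single H hxy]
      have e1 : (-1 : ℝ) ^ (p x).length = τ x := rfl
      have e2 : (-1 : ℝ) ^ (p y).length = τ x := hτxy.symm
      rw [e1, e2, hc]
      linear_combination (ρ * (Pi.single r 1 : W → ℝ) z) * hτsq x
    · have hG : ∑ e, (P x e + P y e - D e) ^ 2 ≤ 9 * n := by
        calc ∑ e, (P x e + P y e - D e) ^ 2
            ≤ ∑ e, (3 * P x e ^ 2 + 3 * P y e ^ 2 + 3 * D e ^ 2) := by
              refine Finset.sum_le_sum fun e _ => ?_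
              nlinarith [sq_nonneg (P x e - P y e), sq_nonneg (P x e + D e),
                sq_nonneg (P y e + D e)]
          _ = 3 * ∑ e, P x e ^ 2 + 3 * ∑ e, P y e ^ 2 + 3 * ∑ e, D e ^ 2 := by
              simp only [Finset.sum_add_distrib, Finset.mul_sum]
          _ ≤ 9 * n := by linarith [hPn x, hPn y]
      have h1 := sum_sq_add_le F fun e => c * (P x e + P y e - D e)
      have h2 : ∑ e, (c * (P x e + P y e - D e)) ^ 2 ≤ n ^ 2 * k ^ 2 / 4 * (9 * n) := by
        simp only [mul_pow, ← Finset.mul_sum]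
        exact mul_le_mul hcn hG (Finset.sum_nonneg fun e _ => sq_nonneg _) (by positivity)
      have h3 : n ^ 2 * k ^ 2 / 4 * (9 * n) = 9 / 4 * (n ^ 3 * k ^ 2) := by ring
      linarith
  · refine ⟨F, fun x => ?_, hFn.trans (by linarith)⟩
    have : ρ = σ r * ∑ u, σ u * K u := by
      rw [hρ, Finset.mul_sum]
      refine Finset.sum_congr rfl fun u _ => ?_
      simp only [hτ]
      rw [neg_one_pow_length (p u) σ hσ hadj]
      ring
    rw [hFs, this, hsum]
    simp

end Graph

/-! ### Norm preservation and stationary states of the walk. -/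

variable {V : Type*} [Fintype V] [DecidableEq V] (G : SimpleGraph V) [DecidableRel G.Adj]

theorem sum_norm_sq_query (M : Finset V) (ψ : State G) :
    ∑ d, ‖query G M ψ d‖ ^ 2 = ∑ d, ‖ψ d‖ ^ 2 := by
  refine Finset.sum_congr rfl fun d _ => ?_
  change ‖if d.fst ∈ M then -ψ d else ψ d‖ ^ 2 = _
  split_ifs <;> simp

omit [DecidableEq V] in
theorem sum_norm_sq_shift (ψ : State G) :
    ∑ d, ‖shift G ψ d‖ ^ 2 = ∑ d, ‖ψ d‖ ^ 2 :=
  Equiv.sum_comp (SimpleGraph.Dart.symm_involutive.toPerm (SimpleGraph.Dart.symm (G := G)))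
    fun d => ‖ψ d‖ ^ 2

theorem sum_norm_sq_reflection {ι : Type*} (s : Finset ι) (z : ι → ℂ) :
    ∑ i ∈ s, ‖2 / (s.card : ℂ) * ∑ j ∈ s, z j - z i‖ ^ 2 = ∑ i ∈ s, ‖z i‖ ^ 2 := by
  rcases s.eq_empty_or_nonempty with rfl | hs
  · simp
  have hn : (s.card : ℂ) ≠ 0 := by
    exact_mod_cast hs.card_ne_zero
  rw [← Complex.ofReal_inj]
  push_cast
  simp only [← Complex.conj_mul', map_sub, map_mul, map_sum, map_div₀, map_natCast, map_ofNat]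
  set S := ∑ j ∈ s, z j with hS
  have hS' : ∑ j ∈ s, (starRingEnd ℂ) (z j) = (starRingEnd ℂ) S := by rw [hS, map_sum]
  rw [hS']
  set T := (starRingEnd ℂ) S
  have h1 : ∀ i, (2 / (s.card : ℂ) * T - (starRingEnd ℂ) (z i)) * (2 / (s.card : ℂ) * S - z i)
      = 2 / (s.card : ℂ) * T * (2 / (s.card : ℂ) * S) - 2 / (s.card : ℂ) * T * z i
        - 2 / (s.card : ℂ) * S * (starRingEnd ℂ) (z i) + (starRingEnd ℂ) (z i) * z i := by
    intro i; ring
  simp only [h1, Finset.sum_add_distrib, Finset.sum_sub_distrib, ← Finset.mul_sum, hS', ← hS,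
    Finset.sum_const, nsmul_eq_mul]
  field_simp
  ring

theorem card_dart_fst (v : V) : #{e : G.Dart | e.fst = v} = G.degree v := by
  have := sum_dart_fst_eq G v fun _ _ => 1
  simpa using this

theorem sum_norm_sq_coin (ψ : State G) :
    ∑ d, ‖coin G ψ d‖ ^ 2 = ∑ d, ‖ψ d‖ ^ 2 := by
  rw [← Finset.sum_fiberwise (s := univ) (g := fun d : G.Dart => d.fst),
    ← Finset.sum_fiberwise (s := univ) (g := fun d : G.Dart => d.fst) (f := fun d => ‖ψ d‖ ^ 2)]
  refine Finset.sum_congr rfl fun v _ => ?_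
  rw [← sum_norm_sq_reflection _ fun d => ψ d, card_dart_fst]
  refine Finset.sum_congr rfl fun d hd => ?_
  simp only [mem_filter, mem_univ, true_and] at hd
  subst hd
  rfl

theorem sum_norm_sq_step_pow (M : Finset V) (t : ℕ) (ψ : State G) :
    ∑ d, ‖(step G M ^ t) ψ d‖ ^ 2 = ∑ d, ‖ψ d‖ ^ 2 := by
  induction t generalizing ψ with
  | zero => simp
  | succ t ih =>
    rw [pow_succ, Module.End.mul_apply, ih]
    exact (sum_norm_sq_shift G _).trans ((sum_norm_sq_coin G _).trans (sum_norm_sq_query G M ψ))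

/-- A symmetric arc function that is constant on the arcs leaving each unmarked vertex and sums
to zero at each marked vertex is fixed by the walk. -/
theorem step_apply_eq_self (M : Finset V) (F : V → V → ℂ) (hsymm : ∀ v w, F v w = F w v)
    (hin : ∀ v ∈ M, ∑ w ∈ G.neighborFinset v, F v w = 0) (a : ℂ)
    (hout : ∀ v ∉ M, ∀ w, F v w = a) :
    step G M (WithLp.toLp 2 fun d => F d.fst d.snd)
      = WithLp.toLp 2 fun d => F d.fst d.snd := by
  ext d
  change 2 / (G.degree d.snd : ℂ) * ∑ e : G.Dart with e.fst = d.snd,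
    (if e.fst ∈ M then -F e.fst e.snd else F e.fst e.snd)
      - (if d.snd ∈ M then -F d.snd d.fst else F d.snd d.fst) = F d.fst d.snd
  rw [sum_dart_fst_eq G d.snd fun v w => if v ∈ M then -F v w else F v w]
  -- At a marked vertex the zero sum makes the coin act as `-1`, which undoes the query; at an
  -- unmarked vertex the constant vector is fixed by the diffusion.
  by_cases h : d.snd ∈ M
  · simp only [h, if_true, Finset.sum_neg_distrib, hin _ h]
    rw [hsymm d.snd]
    ring
  · have hd : (G.degree d.snd : ℂ) ≠ 0 := by
      have : 0 < G.degree d.snd := (G.degree_pos_iff_exists_adj _).2 ⟨d.fst, d.adj.symm⟩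
      exact_mod_cast this.ne'
    simp only [h, if_false, hout _ h, Finset.sum_const, SimpleGraph.card_neighborFinset_eq_degree,
      nsmul_eq_mul, hsymm d.fst]
    field_simp
    ring

theorem successProb_le_of_fixed (M : Finset V) (t : ℕ) (φ : State G) (hφ : step G M φ = φ) :
    successProb G M t ≤
      2 * ∑ d : G.Dart with d.fst ∈ M, ‖φ d‖ ^ 2 + 2 * ∑ d, ‖initial G d - φ d‖ ^ 2 := by
  have hfix : (step G M ^ t) φ = φ := by
    induction t with
    | zero => simp
    | succ t ih => rw [pow_succ, Module.End.mul_apply, hφ, ih]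
  have h1 := sum_norm_sq_step_pow G M t (initial G - φ)
  simp only [map_sub, hfix, PiLp.sub_apply] at h1
  rw [← h1, Finset.mul_sum, successProb]
  calc _ ≤ ∑ d : G.Dart with d.fst ∈ M,
        (2 * ‖φ d‖ ^ 2 + 2 * ‖(step G M ^ t) (initial G) d - φ d‖ ^ 2) := by
        refine Finset.sum_le_sum fun d _ => ?_
        have h2 := norm_add_le (φ d) ((step G M ^ t) (initial G) d - φ d)
        rw [add_sub_cancel] at h2
        have h3 := pow_le_pow_left₀ (norm_nonneg _) h2 2
        nlinarith [sq_nonneg (‖φ d‖ - ‖(step G M ^ t) (initial G) d - φ d‖)]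
    _ ≤ _ := by
        rw [Finset.sum_add_distrib]
        simp only [Finset.mul_sum]
        gcongr
        exact Finset.filter_subset _ _

/-! ### Degree and edge counts inside and across the marked set. -/

theorem sum_neighborFinset_split {R : Type*} [AddCommMonoid R] (M : Finset V)
    (v : (M : Set V)) (g : V → R) :
    ∑ w ∈ G.neighborFinset v.1, g w
      = ∑ w ∈ (G.induce (M : Set V)).neighborFinset v, g w.1
        + ∑ w ∈ G.neighborFinset v.1 \ M, g w := by
  rw [← Finset.sum_inter_add_sum_sdiff (G.neighborFinset v.1) M]
  congr 1
  refine (Finset.sum_bij (fun w _ => w.1) ?_ ?_ ?_ ?_).symm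
  · intro w hw
    have := w.2
    simp_all
  · intro w _ w' _ h
    exact Subtype.ext h
  · intro w hw
    simp only [mem_inter, SimpleGraph.mem_neighborFinset] at hw
    exact ⟨⟨w, hw.2⟩, by simpa using hw.1, rfl⟩
  · intro w _
    rfl

theorem degree_eq_induce_add (M : Finset V) (v : (M : Set V)) :
    G.degree v.1 = (G.induce (M : Set V)).degree v + #(G.neighborFinset v.1 \ M) := by
  have := sum_neighborFinset_split G M v fun _ => 1
  simpa using this

theorem boundaryEdges_eq_sum (M : Finset V) :
    boundaryEdges G M = ∑ v ∈ M, #(G.neighborFinset v \ M) := by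
  rw [boundaryEdges, SimpleGraph.interedges_def, Finset.card_filter, Finset.sum_product]
  refine Finset.sum_congr rfl fun v _ => ?_
  rw [← Finset.card_filter]
  congr 1
  ext w
  simp [and_comm]

theorem two_mul_innerEdges_add_boundaryEdges (M : Finset V) :
    2 * innerEdges G M + boundaryEdges G M = ∑ v ∈ M, G.degree v := by
  rw [boundaryEdges_eq_sum, innerEdges, ← SimpleGraph.sum_degrees_eq_twice_card_edges,
    Finset.sum_subtype M (p := (· ∈ (M : Set V))) (by simp),
    Finset.sum_subtype M (p := (· ∈ (M : Set V))) (by simp), ← Finset.sum_add_distrib]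
  exact Finset.sum_congr rfl fun v _ => (degree_eq_induce_add G M v).symm

/-- Shows that the denominator of the bound is positive. -/
theorem two_mul_card_edges_sub (M : Finset V) :
    2 * (#G.edgeFinset : ℝ) - 2 * (innerEdges G M : ℝ) - (boundaryEdges G M : ℝ)
      = ((∑ v ∈ Mᶜ, G.degree v : ℕ) : ℝ) := by
  have h1 := two_mul_innerEdges_add_boundaryEdges G M
  have h2 := G.sum_degrees_eq_twice_card_edges
  rw [← Finset.sum_add_sum_compl M, ← h1] at h2
  have h3 : (((2 * innerEdges G M + boundaryEdges G M) + ∑ v ∈ Mᶜ, G.degree v : ℕ) : ℝ)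
    = ((2 * #G.edgeFinset : ℕ) : ℝ) := by rw [h2]
  push_cast at h3 ⊢
  linarith

theorem card_outer_le (M : Finset V) {v : V} (hv : v ∈ M) :
    (#(G.neighborFinset v \ M) : ℝ) ≤ ‖conditioning G M‖ := by
  have := norm_le_pi_norm (conditioning G M) ⟨v, hv⟩
  simpa [conditioning] using this

theorem one_le_norm_conditioning (hG : G.Connected) (M : Finset V) (h1 : 0 < #M)
    (h2 : #M < Fintype.card V) : 1 ≤ ‖conditioning G M‖ := by
  obtain ⟨u, hu⟩ := Finset.card_pos.1 h1
  obtain ⟨v, hv⟩ : ∃ v, v ∉ M := by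
    by_contra! h
    exact h2.ne ((Finset.card_eq_iff_eq_univ M).2 (Finset.eq_univ_iff_forall.2 h))
  obtain ⟨p⟩ := hG.preconnected u v
  obtain ⟨d, -, hd1, hd2⟩ := p.exists_boundary_dart (M : Set V) hu hv
  refine le_trans ?_ (card_outer_le G M hd1)
  have : 0 < #(G.neighborFinset d.fst \ M) :=
    Finset.card_pos.2 ⟨d.snd, by simpa using hd2⟩
  exact_mod_cast this

/-! ### The stationary state of a SAMC and the resulting bound. -/

/-- Each inner edge adds one to the inner degree sum of both parts, so equal sums of `G`-degrees
force equal numbers of outgoing edges. -/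
theorem IsSAMC.exists_sign {M : Finset V} (h : IsSAMC G M) :
    ¬ (G.induce (M : Set V)).IsBipartite ∨ ∃ σ : ↥(M : Set V) → ℝ, (∀ x, σ x ^ 2 = 1) ∧
      (∀ x y, (G.induce (M : Set V)).Adj x y → σ x = -σ y) ∧
      ∑ x, σ x * -(#(G.neighborFinset x.1 \ M) : ℝ) = 0 := by
  refine h.balanced.imp_right ?_
  rintro ⟨U, hUM, hU, hdeg⟩
  set H := G.induce (M : Set V)
  have hadj : ∀ x y, H.Adj x y →
      (if x.1 ∈ U then (1 : ℝ) else -1) = -(if y.1 ∈ U then (1 : ℝ) else -1) := by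
    intro x y hxy
    rcases hU.mem_of_adj hxy with ⟨h1, h2⟩ | ⟨h1, h2⟩ <;>
    simp_all
  refine ⟨fun x => if x.1 ∈ U then 1 else -1, fun x => by dsimp only; split_ifs <;> norm_num,
    hadj, ?_⟩
  set σ : ↥(M : Set V) → ℝ := fun x => if x.1 ∈ U then 1 else -1
  have hinner : ∑ x, σ x * (H.degree x : ℝ) = 0 := by
    have e : ∀ x, σ x * (H.degree x : ℝ) = ∑ y, if H.Adj x y then σ x else 0 := by
      intro x
      rw [← Finset.sum_filter, ← SimpleGraph.neighborFinset_eq_filter, Finset.sum_const,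
        SimpleGraph.card_neighborFinset_eq_degree, nsmul_eq_mul, mul_comm]
    have e2 : ∑ x, ∑ y, (if H.Adj x y then σ x else 0)
        = -∑ x, ∑ y, (if H.Adj x y then σ x else 0) := by
      conv_lhs => rw [Finset.sum_comm]
      rw [← Finset.sum_neg_distrib]
      refine Finset.sum_congr rfl fun y _ => ?_
      rw [← Finset.sum_neg_distrib]
      refine Finset.sum_congr rfl fun x _ => ?_
      by_cases hxy : H.Adj x y
      · simp only [hxy, hxy.symm, if_true]
        exact hadj x y hxy
      · have : ¬ H.Adj y x := fun h => hxy h.symm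
        simp [hxy, this]
    simp only [e]
    linarith
  have htotal : ∑ x : (M : Set V), σ x * (G.degree x.1 : ℝ) = 0 := by
    rw [← Finset.sum_subtype M (p := (· ∈ (M : Set V))) (by simp)
      (fun v => (if v ∈ U then (1 : ℝ) else -1) * (G.degree v : ℝ)),
      ← Finset.sum_sdiff hUM]
    have e1 : ∑ x ∈ M \ U, (if x ∈ U then (1 : ℝ) else -1) * (G.degree x : ℝ)
        = -((∑ x ∈ M \ U, G.degree x : ℕ) : ℝ) := by
      push_cast
      rw [← Finset.sum_neg_distrib]
      refine Finset.sum_congr rfl fun x hx => ?_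
      simp [(Finset.mem_sdiff.1 hx).2]
    have e2 : ∑ x ∈ U, (if x ∈ U then (1 : ℝ) else -1) * (G.degree x : ℝ)
        = ((∑ x ∈ U, G.degree x : ℕ) : ℝ) := by
      push_cast
      refine Finset.sum_congr rfl fun x hx => ?_
      simp [hx]
    rw [e1, e2, hdeg]
    ring
  have hsplit : ∀ x : (M : Set V), σ x * -(#(G.neighborFinset x.1 \ M) : ℝ)
      = σ x * (H.degree x : ℝ) - σ x * (G.degree x.1 : ℝ) := by
    intro x
    rw [degree_eq_induce_add G M x]
    push_cast
    ring
  rw [Finset.sum_congr rfl fun x _ => hsplit x, Finset.sum_sub_distrib, hinner, htotal, sub_zero]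

/-- An arc function that sums to zero at each marked vertex and equals one off the marked
component, of small energy on the marked arcs. -/
theorem IsSAMC.exists_arc_weight {M : Finset V} (h : IsSAMC G M) :
    ∃ F : V → V → ℝ, (∀ v w, F v w = F w v) ∧
      (∀ v ∈ M, ∑ w ∈ G.neighborFinset v, F v w = 0) ∧ (∀ v ∉ M, ∀ w, F v w = 1) ∧
      ∑ v ∈ M, ∑ w ∈ G.neighborFinset v, F v w ^ 2
        ≤ 16 * ((#M : ℝ) ^ 3 * ‖conditioning G M‖ ^ 2) + #M * ‖conditioning G M‖ := by
  obtain ⟨f, hf, hfn⟩ := exists_edge_weight (G.induce (M : Set V)) h.connected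
    (fun x => -(#(G.neighborFinset x.1 \ M) : ℝ)) ‖conditioning G M‖
    (fun x => by simpa using card_outer_le G M x.2) (h.exists_sign G)
  have hcard : Fintype.card (M : Set V) = #M := by simp
  rw [hcard] at hfn
  set F : V → V → ℝ := fun v w =>
    if h : v ∈ M ∧ w ∈ M then f s(⟨v, h.1⟩, ⟨w, h.2⟩) else 1 with hF
  have hFin : ∀ x y : (M : Set V), F x.1 y.1 = f s(x, y) := fun x y => dif_pos ⟨x.2, y.2⟩
  have hFout : ∀ v w, w ∉ M → F v w = 1 := fun v w hw => dif_neg fun h => hw h.2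
  have hsum : ∀ x : (M : Set V), ∑ w ∈ G.neighborFinset x.1, F x.1 w ^ 2
      = ∑ y ∈ (G.induce (M : Set V)).neighborFinset x, f s(x, y) ^ 2
        + #(G.neighborFinset x.1 \ M) := by
    intro x
    rw [sum_neighborFinset_split]
    simp only [hFin]
    congr 1
    rw [Finset.sum_congr rfl (g := fun _ => 1)]
    · simp
    · intro w hw
      rw [hFout _ _ (Finset.mem_sdiff.1 hw).2, one_pow]
  refine ⟨F, fun v w => ?_, fun v hv => ?_, fun v hv w => dif_neg fun h => hv h.1, ?_⟩
  · by_cases h : v ∈ M ∧ w ∈ M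
    · simp only [hF, h, and_self, dif_pos]
      rw [Sym2.eq_swap]
    · simp only [hF, dif_neg h, dif_neg fun h' => h (And.symm h')]
  · rw [sum_neighborFinset_split G M ⟨v, hv⟩]
    simp only [fun y => hFin ⟨v, hv⟩ y, hf]
    rw [Finset.sum_congr rfl (g := fun _ => (1 : ℝ))]
    · simp
    · intro w hw
      exact hFout _ _ (Finset.mem_sdiff.1 hw).2
  · rw [Finset.sum_subtype M (p := (· ∈ (M : Set V))) (by simp),
      Finset.sum_congr rfl fun x _ => hsum x, Finset.sum_add_distrib]
    -- Each inner edge carries two arcs, which turns the constant 8 into 16.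
    have h1 := sum_neighbor_edge_le (G.induce (M : Set V)) (fun e => f e ^ 2)
      fun e => sq_nonneg _
    have h2 : ∑ x : (M : Set V), (#(G.neighborFinset x.1 \ M) : ℝ)
        ≤ #M * ‖conditioning G M‖ := by
      calc _ ≤ ∑ _x : (M : Set V), ‖conditioning G M‖ :=
            Finset.sum_le_sum fun x _ => card_outer_le G M x.2
        _ = _ := by rw [Finset.sum_const, nsmul_eq_mul, Finset.card_univ, hcard]
    linarith

theorem sum_degree_le (M : Finset V) :
    ((∑ v ∈ M, G.degree v : ℕ) : ℝ) ≤ #M * (#M + ‖conditioning G M‖) := by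
  push_cast
  rw [← nsmul_eq_mul, ← Finset.sum_const]
  refine Finset.sum_le_sum fun v hv => ?_
  have h1 := degree_eq_induce_add G M ⟨v, hv⟩
  have h2 := card_outer_le G M hv
  have h3 := ((G.induce (M : Set V)).degree_lt_card_verts ⟨v, hv⟩).le
  have hcard : Fintype.card (M : Set V) = #M := by simp
  rw [hcard] at h3
  have h4 : ((G.induce (M : Set V)).degree ⟨v, hv⟩ : ℝ) ≤ #M := by exact_mod_cast h3
  rw [h1]
  push_cast
  linarith

theorem IsSAMC.successProb_le {M : Finset V} (h : IsSAMC G M) (t : ℕ) :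
    successProb G M t ≤ 1 / (2 * (#G.edgeFinset : ℝ)) *
      (6 * (16 * ((#M : ℝ) ^ 3 * ‖conditioning G M‖ ^ 2) + #M * ‖conditioning G M‖)
        + 4 * (#M * (#M + ‖conditioning G M‖))) := by
  obtain ⟨F, hsymm, hin, hout, hF⟩ := h.exists_arc_weight G
  set a : ℝ := 1 / Real.sqrt (2 * (#G.edgeFinset : ℝ)) with ha
  have hasq : a ^ 2 = 1 / (2 * (#G.edgeFinset : ℝ)) := by
    rw [ha, div_pow, one_pow, Real.sq_sqrt (by positivity)]
  have hfix := step_apply_eq_self G M (fun v w => ((a * F v w : ℝ) : ℂ))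
    (fun v w => by simp only [hsymm v w])
    (fun v hv => by rw [← Complex.ofReal_sum, ← Finset.mul_sum, hin v hv]; simp)
    (a : ℂ) (fun v hv w => by rw [hout v hv w, mul_one])
  have h1 := successProb_le_of_fixed G M t _ hfix
  have h2 : ∑ d : G.Dart with d.fst ∈ M, ‖((a * F d.fst d.snd : ℝ) : ℂ)‖ ^ 2
      = a ^ 2 * ∑ v ∈ M, ∑ w ∈ G.neighborFinset v, F v w ^ 2 := by
    rw [← sum_dart_fst_mem G M fun v w => F v w ^ 2, Finset.mul_sum]
    refine Finset.sum_congr rfl fun d _ => ?_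
    rw [Complex.norm_real, Real.norm_eq_abs, sq_abs, mul_pow]
  have h3 : ∑ d : G.Dart, ‖initial G d - ((a * F d.fst d.snd : ℝ) : ℂ)‖ ^ 2
      ≤ a ^ 2 * (2 * ((∑ v ∈ M, G.degree v : ℕ) : ℝ)
        + 2 * ∑ v ∈ M, ∑ w ∈ G.neighborFinset v, F v w ^ 2) := by
    have e1 : ∀ d : G.Dart, ‖initial G d - ((a * F d.fst d.snd : ℝ) : ℂ)‖ ^ 2
        = a ^ 2 * (1 - F d.fst d.snd) ^ 2 := by
      intro d
      have : initial G d = ((a : ℝ) : ℂ) := by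
        change (1 / (Real.sqrt (2 * (#G.edgeFinset : ℝ)) : ℂ)) = _
        rw [ha]
        push_cast
        rfl
      rw [this, ← Complex.ofReal_sub, Complex.norm_real, Real.norm_eq_abs, sq_abs]
      ring
    have e2 : ∑ d : G.Dart, (1 - F d.fst d.snd) ^ 2
        = ∑ v ∈ M, ∑ w ∈ G.neighborFinset v, (1 - F v w) ^ 2 := by
      rw [← sum_dart_fst_mem G M fun v w => (1 - F v w) ^ 2]
      symm
      refine Finset.sum_subset (Finset.filter_subset _ _) fun d _ hd => ?_
      simp only [mem_filter, mem_univ, true_and] at hd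
      simp [hout _ hd]
    simp only [e1]
    rw [← Finset.mul_sum, e2]
    refine mul_le_mul_of_nonneg_left ?_ (sq_nonneg a)
    calc _ ≤ ∑ v ∈ M, ∑ w ∈ G.neighborFinset v, (2 + 2 * F v w ^ 2) := by
          refine Finset.sum_le_sum fun v _ => Finset.sum_le_sum fun w _ => ?_
          nlinarith [sq_nonneg (1 + F v w)]
      _ = _ := by
          simp only [Finset.sum_add_distrib, Finset.sum_const, nsmul_eq_mul, Finset.mul_sum,
            SimpleGraph.card_neighborFinset_eq_degree]
          push_cast
          rw [Finset.mul_sum]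
          simp only [mul_comm]
  have h4 := sum_degree_le G M
  rw [← hasq]
  refine h1.trans ?_
  change 2 * (∑ d : G.Dart with d.fst ∈ M, ‖((a * F d.fst d.snd : ℝ) : ℂ)‖ ^ 2)
    + 2 * (∑ d : G.Dart, ‖initial G d - ((a * F d.fst d.snd : ℝ) : ℂ)‖ ^ 2) ≤ _
  rw [h2]
  have h5 := mul_le_mul_of_nonneg_left hF (sq_nonneg a)
  have h6 := mul_le_mul_of_nonneg_left h4 (sq_nonneg a)
  linarith

end CoinedWalk

theorem mainTheorem1 :
    ∃ C : ℝ, 0 < C ∧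
      ∀ (V : Type*) [Fintype V] [DecidableEq V] (G : SimpleGraph V) [DecidableRel G.Adj]
        (M : Finset V), G.Connected → CoinedWalk.IsSAMC G M →
        ∀ t : ℕ,
          CoinedWalk.successProb G M t ≤
            C * (((M.card : ℝ) ^ 3 * ‖CoinedWalk.conditioning G M‖ ^ 2) /
              (2 * (G.edgeFinset.card : ℝ) - 2 * (CoinedWalk.innerEdges G M : ℝ)
                - (CoinedWalk.boundaryEdges G M : ℝ))) := by
  -- 110 = 6 * (16 + 1) + 4 * (1 + 1), once `n * k` and `n * n` are absorbed into `n ^ 3 * k ^ 2`;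
  -- this uses `1 ≤ k`, which holds because connectedness gives an edge leaving `M`.
  refine ⟨110, by norm_num, fun V _ _ G _ M hG h t => ?_⟩
  have hk := CoinedWalk.one_le_norm_conditioning G hG M (zero_lt_one.trans h.one_lt_card) h.card_lt
  have hn : (1 : ℝ) ≤ M.card := by exact_mod_cast h.one_lt_card.le
  have hden : 0 < 2 * (G.edgeFinset.card : ℝ) - 2 * (CoinedWalk.innerEdges G M : ℝ)
      - (CoinedWalk.boundaryEdges G M : ℝ) := by
    rw [CoinedWalk.two_mul_card_edges_sub]
    obtain ⟨v, hv⟩ : ∃ v, v ∉ M := by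
      by_contra! hall
      exact h.card_lt.ne ((Finset.card_eq_iff_eq_univ M).2 (Finset.eq_univ_iff_forall.2 hall))
    have : Nontrivial V := Fintype.one_lt_card_iff_nontrivial.1 (h.one_lt_card.trans h.card_lt)
    have hpos : 0 < G.degree v := hG.preconnected.degree_pos_of_nontrivial v
    have := Finset.single_le_sum (f := fun v => G.degree v) (fun _ _ => Nat.zero_le _)
      (Finset.mem_compl.2 hv)
    exact_mod_cast hpos.trans_le this
  refine (h.successProb_le G t).trans ?_
  set k := ‖CoinedWalk.conditioning G M‖
  set n : ℝ := (M.card : ℝ)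
  set den := 2 * (G.edgeFinset.card : ℝ) - 2 * (CoinedWalk.innerEdges G M : ℝ)
      - (CoinedWalk.boundaryEdges G M : ℝ)
  -- The estimate so far has the larger denominator `2 * |E|`.
  have hle : den ≤ 2 * (G.edgeFinset.card : ℝ) := by
    have h1 : (0 : ℝ) ≤ CoinedWalk.innerEdges G M := Nat.cast_nonneg _
    have h2 : (0 : ℝ) ≤ CoinedWalk.boundaryEdges G M := Nat.cast_nonneg _
    linarith
  have hnk : n * k ≤ n ^ 3 * k ^ 2 :=
    mul_le_mul (le_self_pow₀ hn (by norm_num)) (le_self_pow₀ hk (by norm_num))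
      (by positivity) (by positivity)
  have hnn : n * n ≤ n ^ 3 * k ^ 2 := by
    calc n * n = n ^ 2 * 1 := by ring
      _ ≤ n ^ 3 * k ^ 2 := mul_le_mul (pow_le_pow_right₀ hn (by norm_num)) (one_le_pow₀ hk)
          zero_le_one (by positivity)
  calc _ ≤ 1 / den * (110 * (n ^ 3 * k ^ 2)) := by
        refine mul_le_mul (one_div_le_one_div_of_le hden hle) (by linarith) (by positivity)
          (by positivity)
    _ = _ := by ring
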